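/- **Theorem.** Let $p\in\mathbb N$, let $a_j>0$ and $\nu_j>0$ for $1\le j\le p$, and let $c_j=\left(\frac{a_j^{2\nu_j}\,\Gamma(\nu_j+\frac12)}{\sqrt{\pi}\,\Gamma(\nu_j)}\right)^{1/2}$. Let $\Sigma=(\sigma_{jk})$ be a complex $p\times p$ matrix, and for $x\in\mathbb R$ let $$f_{jk}(x)=c_jc_k\,(a_j+\mathrm i x)^{-\nu_j-\frac12}\,\{\Re(\sigma_{jk})+\mathrm i\,\Im(\sigma_{jk})\,\mathrm{sign}(x)\}\,(a_k-\mathrm i x)^{-\nu_k-\frac12}$$ (principal powers). Fix $j,k$ with $\Im(\sigma_{jk})=0$. Then $f_{jk}$ is integrable on $\mathbb R$. Put $$C_{jk}(h)=\int_{\mathbb R}e^{\mathrm i hx}f_{jk}(x)\,dx,\qquad h\in\mathbb R .$$ If $Y=(Y_1,\dots,Y_p)$ is a real, zero-mean, second-order, covariance-stationary process on $\mathbb R$ with matrix-valued spectral density $(f_{jk})$ (for which $\Sigma$ is taken Hermitian and positive semidefinite), then $\mathbb E[Y_j(s+h)Y_k(s)]=C_{jk}(h)$ for all $s,h\in\mathbb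 R$. Write $a_\pm=\frac{a_j\pm a_k}2$ and $\nu_\pm=\frac{\nu_j\pm\nu_k}2$, and for $z>0$ let $$W_{\kappa,\mu}(z)=e^{-z/2}z^{\frac12+\mu}\,U\!\left(\tfrac12+\mu-\kappa,\,1+2\mu,\,z\right)$$ be the Whittaker function, where $U(a,b,\cdot)$ is Tricomi's confluent hypergeometric function, that is, the solution on $(0,\infty)$ of Kummer's equation $zw''+(b-z)w'-aw=0$ with $z^{a}w(z)\to1$ as $z\to\infty$. Then $$C_{jk}(h)=\Re(\sigma_{jk})\,c_jc_k\,\frac{\pi}{a_+}\left(\frac{|h|}{2a_+}\right)^{\nu_+-\frac12}e^{-ha_-}\times\begin{cases}\dfrac{W_{\nu_-,\nu_+}(2a_+|h|)}{\Gamma(\nu_j+\frac12)},&h>0,\\[2ex]\dfrac{W_{-\nu_-,\nu_+}(2a_+|h|)}{\Gamma(\nu_k+\frac12)},&h<0,\end{cases}$$ and $$C_{jk}(0)=\Re(\sigma_{jk})\,\frac{a_j^{\nu_j}a_k^{\nu_k}}{a_+^{2\nu_+}}\,\frac{\Gamma(2\nu_+)}{\sqrt{\Gamma(2\nu_j)\Gamma(2\nu_k)}}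 .$$ -/

import Mathlib

open MeasureTheory Filter Topology
open scoped ComplexOrder

/-- `w`, restricted to the half-line `z > 0`, is Tricomi's confluent hypergeometric function
`U(a, b, ·)`: it solves Kummer's equation `z w'' + (b - z) w' - a w = 0` there, and
`w z ∼ z ^ (-a)` as `z → ∞`. These two properties determine `w` on `z > 0`, because a solution
that is not a multiple of `U(a, b, ·)` grows like `exp z * z ^ (a - b)`. -/
def IsTricomiU (a b : ℝ) (w : ℝ → ℝ) : Prop :=
  (∀ z : ℝ, 0 < z →
    DifferentiableAt ℝ w z ∧ DifferentiableAt ℝ (deriv w) z ∧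
      z * deriv (deriv w) z + (b - z) * deriv w z - a * w z = 0) ∧
  Tendsto (fun z : ℝ => z ^ a * w z) atTop (𝓝 1)

/-- The confluent hypergeometric function `U(a, b, z)` of Tricomi, for real `a`, `b` and `z > 0`:
the solution of Kummer's equation on `z > 0` that is asymptotic to `z ^ (-a)` at infinity
(no meaning is attached to the values at `z ≤ 0`). -/
noncomputable def tricomiU (a b z : ℝ) : ℝ :=
  Classical.epsilon (IsTricomiU a b) z

/-- The Whittaker function `W_{κ, μ}(z)`, for real `κ`, `μ` and `z > 0`. -/
noncomputable def whittakerW (κ μ z : ℝ) : ℝ :=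
  Real.exp (-(1 / 2) * z) * z ^ (1 / 2 + μ) * tricomiU (1 / 2 + μ - κ) (1 + 2 * μ) z

/-- The normalising constant `c(d, ν, a) > 0` of the Matérn spectral density in dimension `d`,
`c(d, ν, a) ^ 2 = a ^ (2 ν) Γ(ν + d / 2) / (π ^ (d / 2) Γ(ν))`. -/
noncomputable def maternConst (d : ℕ) (ν a : ℝ) : ℝ :=
  Real.sqrt (a ^ (2 * ν) * Real.Gamma (ν + d / 2) / (Real.pi ^ ((d : ℝ) / 2) * Real.Gamma ν))

/-- The matrix-valued spectral density of the multivariate Matérn model in dimension one, with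
inverse ranges `a j`, smoothness parameters `ν j` and directional matrix `S = (σ_jk)`; powers of
complex numbers are principal. -/
noncomputable def maternSpectralDensity {p : ℕ} (a ν : Fin p → ℝ) (S : Matrix (Fin p) (Fin p) ℂ)
    (x : ℝ) : Matrix (Fin p) (Fin p) ℂ :=
  Matrix.of fun j k =>
    (maternConst 1 (ν j) (a j) : ℂ) * (maternConst 1 (ν k) (a k) : ℂ) *
      ((a j : ℂ) + Complex.I * (x : ℂ)) ^ (-(ν j : ℂ) - 1 / 2) *
      (((S j k).re : ℂ) + Complex.I * ((S j k).im : ℂ) * (Real.sign x : ℂ)) *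
      ((a k : ℂ) - Complex.I * (x : ℂ)) ^ (-(ν k : ℂ) - 1 / 2)

/-- The matrix-valued covariance function `C(h) = ∫ exp (i h x) f(x) dx` (taken entrywise) with
spectral density `f`. -/
noncomputable def spectralCov {p : ℕ} (f : ℝ → Matrix (Fin p) (Fin p) ℂ) (h : ℝ) :
    Matrix (Fin p) (Fin p) ℂ :=
  Matrix.of fun j k => ∫ x : ℝ, Complex.exp (Complex.I * (h : ℂ) * (x : ℂ)) * f x j k

/-- `Y` is a zero-mean, second-order, covariance-stationary process on the real line with values
in `ℝ^p`, and `f` is its spectral density: an integrable function with positive semidefinite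
values for which `f(x) dx` is the spectral measure in Bochner's representation of the
covariances of `Y`. -/
structure HasSpectralDensity {p : ℕ} {Ω : Type*} [MeasurableSpace Ω] (P : Measure Ω)
    (Y : ℝ → Ω → Fin p → ℝ) (f : ℝ → Matrix (Fin p) (Fin p) ℂ) : Prop where
  memLp : ∀ (s : ℝ) (j : Fin p), MemLp (fun ω => Y s ω j) 2 P
  mean_zero : ∀ (s : ℝ) (j : Fin p), ∫ ω, Y s ω j ∂P = 0
  integrable : ∀ j k : Fin p, Integrable (fun x : ℝ => f x j k)
  posSemidef : ∀ᵐ x : ℝ, (f x).PosSemidef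
  cov_eq : ∀ (t s : ℝ) (j k : Fin p),
    ((∫ ω, Y t ω j * Y s ω k ∂P : ℝ) : ℂ) = spectralCov f (t - s) j k

/-! When Im σ_jk = 0 the density is a constant times (a_j + ix)^(-α) (a_k - ix)^(-β), with α = ν_j +
1/2 and β = ν_k + 1/2. By Euler's integral with a complex rate (`integral_rpow_mul_cexp_neg`), each
factor is, up to a Gamma value, the transform of a Gamma density, the second one reflected. The
product is thus the transform of their cross-correlation, and Fourier inversion gives the covariance
for h > 0 (`maternCov_of_pos`). The substitution s = ht turns the correlation into a Laplace
integral (`gammaCorrelation_of_pos`), which is Γ(β) U(β, α + β, (a_j + a_k)h). Negative h follows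
from x ↦ -x (`maternCov_neg`), and h = 0 from a right-hand limit (`maternCov_zero`).

Since U is specified only by its equation and its behaviour at infinity, it has to be identified
with the Laplace integral (`tricomiU_eq_kummerIntegral`). The integral meets the specification
(`isTricomiU_kummerIntegral`), and a Wronskian argument gives uniqueness (`IsTricomiU.eq_of_pos`).
-/

/-! ### The Laplace integral as a solution of Kummer's equation -/

lemma one_add_rpow_le_exp (q : ℝ) {ε : ℝ} (hε : 0 < ε) :
    ∃ K : ℝ, 0 ≤ K ∧ ∀ t : ℝ, 0 ≤ t → (1 + t) ^ q ≤ K * Real.exp (ε * t) := by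
  -- δ is the slope of a tangent line lying above log; the `+ 1` covers q = 0.
  set δ : ℝ := ε / (|q| + 1) with hδ
  have hq : 0 < |q| + 1 := by positivity
  have hδ0 : 0 < δ := by positivity
  have hδε : |q| * δ ≤ ε := by
    rw [hδ, mul_div_assoc', div_le_iff₀ hq]
    nlinarith [abs_nonneg q]
  refine ⟨Real.exp (|q| * (δ - 1 - Real.log δ)), (Real.exp_pos _).le, fun t ht => ?_⟩
  have h1 : (0 : ℝ) < 1 + t := by linarith
  rw [Real.rpow_def_of_pos h1, ← Real.exp_add]
  apply Real.exp_le_exp.2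
  have h2 : Real.log (1 + t) ≤ δ * (1 + t) - 1 - Real.log δ := by
    have := Real.log_le_sub_one_of_pos (mul_pos hδ0 h1)
    rw [Real.log_mul hδ0.ne' h1.ne'] at this
    linarith
  have h3 : 0 ≤ Real.log (1 + t) := Real.log_nonneg (by linarith)
  calc Real.log (1 + t) * q ≤ Real.log (1 + t) * |q| :=
        mul_le_mul_of_nonneg_left (le_abs_self q) h3
    _ ≤ (δ * (1 + t) - 1 - Real.log δ) * |q| := mul_le_mul_of_nonneg_right h2 (abs_nonneg q)
    _ ≤ |q| * (δ - 1 - Real.log δ) + ε * t := by nlinarith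

/-- The Laplace-type integral underlying the integral representation of Tricomi's function. -/
noncomputable def kummerIntegral (p q z : ℝ) : ℝ :=
  ∫ t in Set.Ioi (0 : ℝ), Real.exp (-z * t) * (t ^ p * (1 + t) ^ q)

lemma continuousOn_kummerIntegrand (p q z : ℝ) :
    ContinuousOn (fun t : ℝ => Real.exp (-z * t) * (t ^ p * (1 + t) ^ q)) (Set.Ioi 0) := by
  intro t ht
  have ht : 0 < t := ht
  have h1 : ContinuousAt (fun t : ℝ => t ^ p) t := Real.continuousAt_rpow_const _ _ (.inl ht.ne')
  have h2 : ContinuousAt (fun t : ℝ => (1 + t) ^ q) t :=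
    (continuousAt_const.add continuousAt_id).rpow_const (.inl (by simp; linarith))
  have h3 : ContinuousAt (fun t : ℝ => Real.exp (-z * t)) t := by fun_prop
  exact (h3.mul (h1.mul h2)).continuousWithinAt

lemma integrableOn_rpow_mul_exp_neg {p z : ℝ} (hp : -1 < p) (hz : 0 < z) :
    IntegrableOn (fun t : ℝ => t ^ p * Real.exp (-z * t)) (Set.Ioi 0) := by
  simpa using integrableOn_rpow_mul_exp_neg_mul_rpow (p := 1) hp one_pos hz

lemma integrableOn_kummerIntegrand {p : ℝ} (hp : -1 < p) (q : ℝ) {z : ℝ} (hz : 0 < z) :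
    IntegrableOn (fun t : ℝ => Real.exp (-z * t) * (t ^ p * (1 + t) ^ q)) (Set.Ioi 0) := by
  obtain ⟨K, hK, hKt⟩ := one_add_rpow_le_exp q (half_pos hz)
  refine Integrable.mono' ((integrableOn_rpow_mul_exp_neg hp (half_pos hz)).const_mul K)
    ((continuousOn_kummerIntegrand p q z).aestronglyMeasurable measurableSet_Ioi) ?_
  refine (ae_restrict_iff' measurableSet_Ioi).2 (ae_of_all _ fun t ht => ?_)
  have ht : 0 < t := ht
  rw [Real.norm_of_nonneg (by positivity)]
  calc Real.exp (-z * t) * (t ^ p * (1 + t) ^ q)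
      ≤ Real.exp (-z * t) * (t ^ p * (K * Real.exp (z / 2 * t))) := by
        have := hKt t ht.le
        gcongr
    _ = K * (t ^ p * (Real.exp (-z * t) * Real.exp (z / 2 * t))) := by ring
    _ = K * (t ^ p * Real.exp (-(z / 2) * t)) := by
        rw [← Real.exp_add]; ring_nf

lemma hasDerivAt_kummerIntegral {p : ℝ} (hp : -1 < p) (q : ℝ) {z : ℝ} (hz : 0 < z) :
    HasDerivAt (kummerIntegral p q) (-kummerIntegral (p + 1) q z) z := by
  have key := hasDerivAt_integral_of_dominated_loc_of_deriv_le
    (μ := volume.restrict (Set.Ioi (0 : ℝ))) (x₀ := z)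
    (F := fun x t => Real.exp (-x * t) * (t ^ p * (1 + t) ^ q))
    (F' := fun x t => -(Real.exp (-x * t) * (t ^ (p + 1) * (1 + t) ^ q)))
    (bound := fun t => Real.exp (-(z / 2) * t) * (t ^ (p + 1) * (1 + t) ^ q))
    (Ioi_mem_nhds (half_lt_self hz))
    (Eventually.of_forall fun x =>
      (continuousOn_kummerIntegrand p q x).aestronglyMeasurable measurableSet_Ioi)
    (integrableOn_kummerIntegrand hp q hz)
    ((continuousOn_kummerIntegrand (p + 1) q z).aestronglyMeasurable measurableSet_Ioi).neg
    ?_ (integrableOn_kummerIntegrand (by linarith) q (half_pos hz)) ?_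
  · have := key.2
    rw [integral_neg] at this
    exact this
  · refine (ae_restrict_iff' measurableSet_Ioi).2 (ae_of_all _ fun t ht x hx => ?_)
    have ht : 0 < t := ht
    have hx : z / 2 < x := hx
    rw [norm_neg, Real.norm_of_nonneg (by positivity)]
    have : Real.exp (-x * t) ≤ Real.exp (-(z / 2) * t) := Real.exp_le_exp.2 (by nlinarith)
    gcongr
  · refine (ae_restrict_iff' measurableSet_Ioi).2 (ae_of_all _ fun t ht x hx => ?_)
    have ht : 0 < t := ht
    have h1 : HasDerivAt (fun x : ℝ => Real.exp (-x * t)) (Real.exp (-x * t) * (-1 * t)) x :=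
      (((hasDerivAt_id x).neg).mul_const t).exp
    convert! h1.mul_const (t ^ p * (1 + t) ^ q) using 1
    rw [Real.rpow_add_one ht.ne']
    ring

lemma kummerIntegral_pos {p : ℝ} (hp : -1 < p) (q : ℝ) {z : ℝ} (hz : 0 < z) :
    0 < kummerIntegral p q z := by
  have hpos : ∀ t ∈ Set.Ioi (0 : ℝ), 0 < Real.exp (-z * t) * (t ^ p * (1 + t) ^ q) := by
    intro t ht
    have ht : 0 < t := ht
    positivity
  rw [kummerIntegral, setIntegral_pos_iff_support_of_nonneg_ae
    ((ae_restrict_iff' measurableSet_Ioi).2 (ae_of_all _ fun t ht => (hpos t ht).le))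
    (integrableOn_kummerIntegrand hp q hz)]
  have : Set.Ioi (0 : ℝ) ⊆ Function.support
      (fun t : ℝ => Real.exp (-z * t) * (t ^ p * (1 + t) ^ q)) := fun t ht => (hpos t ht).ne'
  rw [Set.inter_eq_right.2 this]
  simp

lemma tendsto_rpow_mul_one_add_rpow_mul_exp_neg (p q : ℝ) {z : ℝ} (hz : 0 < z) :
    Tendsto (fun t : ℝ => Real.exp (-z * t) * (t ^ p * (1 + t) ^ q)) atTop (𝓝 0) := by
  obtain ⟨K, hK, hKt⟩ := one_add_rpow_le_exp q (half_pos hz)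
  have h0 := (tendsto_rpow_mul_exp_neg_mul_atTop_nhds_zero p (z / 2) (half_pos hz)).const_mul K
  rw [mul_zero] at h0
  refine squeeze_zero' ?_ ?_ h0
  · filter_upwards [eventually_gt_atTop 0] with t ht
    positivity
  · filter_upwards [eventually_gt_atTop 0] with t ht
    calc Real.exp (-z * t) * (t ^ p * (1 + t) ^ q)
        ≤ Real.exp (-z * t) * (t ^ p * (K * Real.exp (z / 2 * t))) := by
          have := hKt t ht.le
          gcongr
      _ = K * (t ^ p * (Real.exp (-z * t) * Real.exp (z / 2 * t))) := by ring
      _ = K * (t ^ p * Real.exp (-(z / 2) * t)) := by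
          rw [← Real.exp_add]; ring_nf

/-- The combined integrand is minus the t-derivative of e^(-zt) t^a (1+t)^(b-a), which vanishes at
both ends. As d/dz raises the power of t by one and changes the sign, this is Kummer's equation for
the integral. -/
lemma kummerIntegral_contiguous {a b z : ℝ} (ha : 0 < a) (hz : 0 < z) :
    z * kummerIntegral (a + 1) (b - a - 1) z - (b - z) * kummerIntegral a (b - a - 1) z
      - a * kummerIntegral (a - 1) (b - a - 1) z = 0 := by
  set q := b - a - 1 with hq
  have i1 := integrableOn_kummerIntegrand (p := a + 1) (by linarith) q hz
  have i2 := integrableOn_kummerIntegrand (p := a) (by linarith) q hz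
  have i3 := integrableOn_kummerIntegrand (p := a - 1) (by linarith) q hz
  have hderiv : ∀ t ∈ Set.Ioi (0 : ℝ),
      HasDerivAt (fun t : ℝ => Real.exp (-z * t) * (t ^ a * (1 + t) ^ (q + 1)))
        (-z * (Real.exp (-z * t) * (t ^ (a + 1) * (1 + t) ^ q))
          + (b - z) * (Real.exp (-z * t) * (t ^ a * (1 + t) ^ q))
          + a * (Real.exp (-z * t) * (t ^ (a - 1) * (1 + t) ^ q))) t := by
    intro t ht
    have ht : 0 < t := ht
    have h1t : 0 < 1 + t := by linarith
    have d1 : HasDerivAt (fun t : ℝ => Real.exp (-z * t)) (Real.exp (-z * t) * (-z * 1)) t :=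
      ((hasDerivAt_id t).const_mul (-z)).exp
    have d2 : HasDerivAt (fun t : ℝ => t ^ a) (a * t ^ (a - 1)) t :=
      Real.hasDerivAt_rpow_const (.inl ht.ne')
    have d3 : HasDerivAt (fun t : ℝ => (1 + t) ^ (q + 1)) (1 * (q + 1) * (1 + t) ^ (q + 1 - 1)) t :=
      ((hasDerivAt_id t).const_add 1).rpow_const (.inl h1t.ne')
    convert! d1.mul (d2.mul d3) using 1
    have e1 : t ^ (a + 1) = t ^ (a - 1) * t * t := by
      rw [← Real.rpow_add_one ht.ne', ← Real.rpow_add_one ht.ne']; ring_nf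
    have e2 : t ^ a = t ^ (a - 1) * t := by
      rw [← Real.rpow_add_one ht.ne']; ring_nf
    rw [Pi.mul_apply, add_sub_cancel_right, e1, e2, Real.rpow_add_one h1t.ne']
    rw [show b = q + a + 1 by rw [hq]; ring]
    ring
  have i12 : IntegrableOn (fun t : ℝ => -z * (Real.exp (-z * t) * (t ^ (a + 1) * (1 + t) ^ q))
      + (b - z) * (Real.exp (-z * t) * (t ^ a * (1 + t) ^ q))) (Set.Ioi 0) :=
    (i1.const_mul (-z)).add (i2.const_mul (b - z))
  have h := integral_Ioi_of_hasDerivAt_of_tendsto (a := 0) (m := 0) ?_ hderiv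
    (i12.add (i3.const_mul a))
    (tendsto_rpow_mul_one_add_rpow_mul_exp_neg a (q + 1) hz)
  · rw [integral_add i12 (i3.const_mul a),
      integral_add (i1.const_mul (-z)) (i2.const_mul (b - z)),
      integral_const_mul, integral_const_mul, integral_const_mul, Real.zero_rpow ha.ne'] at h
    simp only [kummerIntegral]
    linarith
  · have h1 : ContinuousAt (fun t : ℝ => t ^ a) 0 := Real.continuousAt_rpow_const _ _ (.inr ha.le)
    have h2 : ContinuousAt (fun t : ℝ => (1 + t) ^ (q + 1)) 0 :=
      (continuousAt_const.add continuousAt_id).rpow_const (.inl (by simp))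
    have h3 : ContinuousAt (fun t : ℝ => Real.exp (-z * t)) 0 := by fun_prop
    exact (h3.mul (h1.mul h2)).continuousWithinAt

/-- A bound valid for either sign of q, used to dominate the integrand uniformly in z ≥ 1. -/
lemma one_add_mul_rpow_le (q : ℝ) {s y : ℝ} (hs : 0 ≤ s) (hy : 0 ≤ y) (hys : y ≤ s) :
    (1 + y) ^ q ≤ 1 + (1 + s) ^ q := by
  rcases le_total 0 q with hq | hq
  · have := Real.rpow_le_rpow (by positivity) (show 1 + y ≤ 1 + s by linarith) hq
    linarith
  · have h1 := Real.rpow_le_one_of_one_le_of_nonpos (show 1 ≤ 1 + y by linarith) hq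
    have h2 : 0 ≤ (1 + s) ^ q := by positivity
    linarith

/-- Substituting s = zt leaves z only in (1 + s/z)^q, which tends to 1; the limit is then Euler's
integral for Γ(a). -/
lemma rpow_mul_kummerIntegral {a z : ℝ} (q : ℝ) (hz : 0 < z) :
    z ^ a * kummerIntegral (a - 1) q z =
      ∫ s in Set.Ioi (0 : ℝ), Real.exp (-1 * s) * (s ^ (a - 1) * (1 + z⁻¹ * s) ^ q) := by
  have h := integral_comp_mul_left_Ioi
    (fun s : ℝ => Real.exp (-1 * s) * (s ^ (a - 1) * (1 + z⁻¹ * s) ^ q)) 0 hz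
  rw [mul_zero, smul_eq_mul] at h
  rw [kummerIntegral, ← mul_right_inj' (inv_ne_zero hz.ne'), ← h, ← mul_assoc, ← integral_const_mul]
  refine setIntegral_congr_fun measurableSet_Ioi fun t ht => ?_
  have ht : 0 < t := ht
  rw [inv_mul_cancel_left₀ hz.ne', Real.mul_rpow hz.le ht.le,
    show z⁻¹ * z ^ a = z ^ (a - 1) by rw [Real.rpow_sub_one hz.ne']; ring]
  ring_nf

lemma tendsto_rpow_mul_kummerIntegral {a : ℝ} (ha : 0 < a) (q : ℝ) :
    Tendsto (fun z : ℝ => z ^ a * kummerIntegral (a - 1) q z) atTop (𝓝 (Real.Gamma a)) := by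
  have hlim : Tendsto (fun z : ℝ => ∫ s in Set.Ioi (0 : ℝ),
      Real.exp (-1 * s) * (s ^ (a - 1) * (1 + z⁻¹ * s) ^ q)) atTop
      (𝓝 (∫ s in Set.Ioi (0 : ℝ), Real.exp (-s) * s ^ (a - 1))) := by
    -- The exponent 0 puts e^(-s) s^(a-1) in the same family of integrands.
    have i1 : IntegrableOn (fun s : ℝ => Real.exp (-1 * s) * (s ^ (a - 1) * (1 + s) ^ (0 : ℝ)))
      (Set.Ioi 0) := integrableOn_kummerIntegrand (p := a - 1) (by linarith) 0 one_pos
    have i2 := integrableOn_kummerIntegrand (p := a - 1) (by linarith) q one_pos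
    refine tendsto_integral_filter_of_dominated_convergence _ ?_ ?_ (i1.add i2) ?_
    · refine Eventually.of_forall fun z => Measurable.aestronglyMeasurable ?_
      fun_prop
    · filter_upwards [eventually_ge_atTop 1] with z hz
      refine (ae_restrict_iff' measurableSet_Ioi).2 (ae_of_all _ fun s hs => ?_)
      have hs : 0 < s := hs
      have hz0 : 0 < z := by linarith
      rw [Real.norm_of_nonneg (by positivity)]
      have := one_add_mul_rpow_le q hs.le (y := z⁻¹ * s) (by positivity)
        (by have := inv_le_one_of_one_le₀ hz; nlinarith)
      simp only [Pi.add_apply, Real.rpow_zero]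
      rw [← mul_add, ← mul_add]
      gcongr
    · refine (ae_restrict_iff' measurableSet_Ioi).2 (ae_of_all _ fun s hs => ?_)
      have h1 : Tendsto (fun z : ℝ => 1 + z⁻¹ * s) atTop (𝓝 (1 + 0 * s)) :=
        (tendsto_inv_atTop_zero.mul_const s).const_add 1
      have h2 := h1.rpow_const (p := q) (.inl (by simp))
      have h3 := (h2.const_mul (s ^ (a - 1))).const_mul (Real.exp (-1 * s))
      simpa using h3
  rw [Real.Gamma_eq_integral ha]
  refine hlim.congr' ?_
  filter_upwards [eventually_gt_atTop 0] with z hz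
  rw [rpow_mul_kummerIntegral q hz]

lemma isTricomiU_kummerIntegral {a : ℝ} (b : ℝ) (ha : 0 < a) :
    IsTricomiU a b fun z => kummerIntegral (a - 1) (b - a - 1) z / Real.Gamma a := by
  set q := b - a - 1 with hq
  have d1 : ∀ z : ℝ, 0 < z → HasDerivAt (fun z => kummerIntegral (a - 1) q z / Real.Gamma a)
      (-kummerIntegral a q z / Real.Gamma a) z := by
    intro z hz
    have := hasDerivAt_kummerIntegral (p := a - 1) (by linarith) q hz
    rw [sub_add_cancel] at this
    exact this.div_const _
  have d2 : ∀ z : ℝ, 0 < z → HasDerivAt (deriv fun z => kummerIntegral (a - 1) q z / Real.Gamma a)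
      (kummerIntegral (a + 1) q z / Real.Gamma a) z := by
    intro z hz
    have := ((hasDerivAt_kummerIntegral (p := a) (by linarith) q hz).neg).div_const (Real.Gamma a)
    rw [neg_neg] at this
    refine this.congr_of_eventuallyEq ?_
    filter_upwards [Ioi_mem_nhds hz] with x hx
    exact (d1 x hx).deriv
  refine ⟨fun z hz => ⟨(d1 z hz).differentiableAt, (d2 z hz).differentiableAt, ?_⟩, ?_⟩
  · rw [(d2 z hz).deriv, (d1 z hz).deriv]
    have := kummerIntegral_contiguous (b := b) ha hz
    have hG := (Real.Gamma_pos_of_pos ha).ne'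
    field_simp
    linarith
  · have := (tendsto_rpow_mul_kummerIntegral ha q).div_const (Real.Gamma a)
    rw [div_self (Real.Gamma_pos_of_pos ha).ne'] at this
    simpa only [mul_div_assoc] using this

/-! ### Uniqueness of Tricomi's function -/

/-- The Wronskian of two solutions of Kummer's equation is a multiple of `exp z * z ^ (-b)`. -/
lemma exists_wronskian_eq {a b : ℝ} {w u : ℝ → ℝ} (hw : IsTricomiU a b w) (hu : IsTricomiU a b u) :
    ∃ c : ℝ, ∀ z : ℝ, 0 < z →
      deriv w z * u z - w z * deriv u z = c * (Real.exp z * z ^ (-b)) := by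
  -- Abel's identity: e^(-z) z^b is the integrating factor for the Wronskian.
  set V : ℝ → ℝ := fun z => (deriv w z * u z - w z * deriv u z) * (Real.exp (-z) * z ^ b) with hV
  have hd : ∀ z ∈ Set.Ioi (0 : ℝ), HasDerivAt V 0 z := by
    intro z hz
    have hz : 0 < z := hz
    obtain ⟨hw1, hw2, hw3⟩ := hw.1 z hz
    obtain ⟨hu1, hu2, hu3⟩ := hu.1 z hz
    have e1 : HasDerivAt (fun z : ℝ => Real.exp (-z)) (Real.exp (-z) * -1) z :=
      (hasDerivAt_neg z).exp
    have e2 : HasDerivAt (fun z : ℝ => z ^ b) (b * z ^ (b - 1)) z :=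
      Real.hasDerivAt_rpow_const (.inl hz.ne')
    convert! ((hw2.hasDerivAt.mul hu1.hasDerivAt).sub (hw1.hasDerivAt.mul hu2.hasDerivAt)).mul
      (e1.mul e2) using 1
    have hzb : z ^ b = z ^ (b - 1) * z := by rw [← Real.rpow_add_one hz.ne']; ring_nf
    simp only [Pi.sub_apply, Pi.mul_apply, hzb]
    linear_combination (-(Real.exp (-z) * z ^ (b - 1) * u z)) * hw3
      + (Real.exp (-z) * z ^ (b - 1) * w z) * hu3
  refine ⟨V 1, fun z hz => ?_⟩
  have hVz : V z = V 1 := by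
    refine isOpen_Ioi.is_const_of_deriv_eq_zero isPreconnected_Ioi
      (fun x hx => (hd x hx).differentiableAt.differentiableWithinAt)
      (fun x hx => (hd x hx).deriv) hz (Set.mem_Ioi.2 one_pos)
  rw [← hVz]
  simp only [hV, Real.rpow_neg hz.le, Real.exp_neg]
  have := (Real.rpow_pos_of_pos hz b).ne'
  field_simp

/-- The derivative of w/u is c e^z z^(-b) / u², of order c e^z z^(2a-b) because u ∼ z^(-a). If c ≠ 0
it is unbounded, which contradicts w/u → 1; so c = 0 and w/u is constantly 1. -/
lemma IsTricomiU.eq_of_pos {a b : ℝ} {w u : ℝ → ℝ} (hw : IsTricomiU a b w) (hu : IsTricomiU a b u)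
    (hpos : ∀ z : ℝ, 0 < z → 0 < u z) {z : ℝ} (hz : 0 < z) : w z = u z := by
  obtain ⟨c, hc⟩ := exists_wronskian_eq hw hu
  have hd : ∀ x ∈ Set.Ioi (0 : ℝ),
      HasDerivAt (fun z => w z / u z) (c * (Real.exp x * x ^ (-b)) / u x ^ 2) x := by
    intro x hx
    rw [← hc x hx]
    exact (hw.1 x hx).1.hasDerivAt.div (hu.1 x hx).1.hasDerivAt (hpos x hx).ne'
  have hlim : Tendsto (fun z => w z / u z) atTop (𝓝 1) := by
    have := hw.2.div hu.2 one_ne_zero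
    rw [div_one] at this
    refine this.congr' ?_
    filter_upwards [eventually_gt_atTop 0] with x hx
    exact mul_div_mul_left _ _ (Real.rpow_pos_of_pos hx a).ne'
  have hc0 : c = 0 := by
    by_contra hne
    have hbig : Tendsto (fun x : ℝ => Real.exp x * x ^ (-b) / u x ^ 2) atTop atTop := by
      have h1 : Tendsto (fun x : ℝ => Real.exp x / x ^ (b - 2 * a)) atTop atTop :=
        tendsto_exp_div_rpow_atTop _
      have h2 : Tendsto (fun x : ℝ => ((x ^ a * u x) ^ 2)⁻¹) atTop (𝓝 1) := by
        simpa using (hu.2.pow 2).inv₀ (by simp)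
      refine (h1.atTop_mul_pos one_pos h2).congr' ?_
      filter_upwards [eventually_gt_atTop 0] with x hx
      rw [Real.rpow_neg hx.le, Real.rpow_sub hx, mul_comm 2 a, Real.rpow_mul hx.le,
        Real.rpow_two]
      have := (Real.rpow_pos_of_pos hx b).ne'
      have := (Real.rpow_pos_of_pos hx a).ne'
      have := (hpos x hx).ne'
      field_simp
    have hstep : Tendsto (fun x : ℝ => w (x + 1) / u (x + 1) - w x / u x) atTop (𝓝 0) := by
      simpa using (hlim.comp (tendsto_atTop_add_const_right _ 1 tendsto_id)).sub hlim
    -- Beyond this threshold the slope of w/u has modulus at least 1, while its increments over unit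
    -- intervals tend to 0.
    obtain ⟨N, hN⟩ := eventually_atTop.1 (hbig.eventually_ge_atTop |c|⁻¹)
    have hsmall : ∀ᶠ x : ℝ in atTop, |w (x + 1) / u (x + 1) - w x / u x| < 1 := by
      have := hstep.abs
      rw [abs_zero] at this
      exact this.eventually_lt_const one_pos
    obtain ⟨x, hx1, hx2, hx3⟩ := (hsmall.and
      ((eventually_gt_atTop (0 : ℝ)).and (eventually_ge_atTop N))).exists
    obtain ⟨ξ, hξ, hξe⟩ := exists_hasDerivAt_eq_slope (fun z => w z / u z)
      (fun x => c * (Real.exp x * x ^ (-b)) / u x ^ 2) (lt_add_one x)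
      (fun y hy => (hd y (lt_of_lt_of_le hx2 hy.1)).continuousAt.continuousWithinAt)
      (fun y hy => hd y (hx2.trans hy.1))
    rw [add_sub_cancel_left, div_one] at hξe
    rw [← hξe, mul_div_assoc, abs_mul] at hx1
    have h5 := hN ξ (hx3.trans hξ.1.le)
    have h6 := h5.trans (le_abs_self _)
    have h7 := mul_le_mul_of_nonneg_left h6 (abs_nonneg c)
    rw [mul_inv_cancel₀ (abs_pos.2 hne).ne'] at h7
    linarith
  subst hc0
  have hconst : ∀ x : ℝ, 0 < x → w x / u x = w z / u z := fun x hx =>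
    isOpen_Ioi.is_const_of_deriv_eq_zero (f := fun z => w z / u z) isPreconnected_Ioi
      (fun x hx => (hd x hx).differentiableAt.differentiableWithinAt)
      (fun x hx => by rw [(hd x hx).deriv]; simp) (Set.mem_Ioi.2 hx) (Set.mem_Ioi.2 hz)
  have h1 : w z / u z = 1 := by
    refine tendsto_nhds_unique (tendsto_const_nhds.congr' ?_) hlim
    filter_upwards [eventually_gt_atTop 0] with x hx
    exact (hconst x hx).symm
  exact (div_eq_one_iff_eq (hpos z hz).ne').1 h1

theorem tricomiU_eq_kummerIntegral {a : ℝ} (b : ℝ) (ha : 0 < a) {z : ℝ} (hz : 0 < z) :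
    tricomiU a b z = kummerIntegral (a - 1) (b - a - 1) z / Real.Gamma a := by
  have hu := isTricomiU_kummerIntegral b ha
  refine IsTricomiU.eq_of_pos (Classical.epsilon_spec ⟨_, hu⟩) hu (fun x hx => ?_) hz
  exact div_pos (kummerIntegral_pos (by linarith) _ hx) (Real.Gamma_pos_of_pos ha)

/-! ### Euler's integral with a complex rate -/

lemma integrableOn_rpow_mul_cexp_neg {α : ℝ} (hα : 0 < α) {r : ℂ} (hr : 0 < r.re) :
    IntegrableOn (fun t : ℝ => ((t ^ (α - 1) : ℝ) : ℂ) * Complex.exp (-(r * t))) (Set.Ioi 0) := by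
  refine Integrable.mono' (integrableOn_rpow_mul_exp_neg (p := α - 1) (by linarith) hr)
    (Measurable.aestronglyMeasurable (by fun_prop)) ?_
  refine (ae_restrict_iff' measurableSet_Ioi).2 (ae_of_all _ fun t ht => ?_)
  have ht : 0 < t := ht
  rw [norm_mul, Complex.norm_real, Real.norm_of_nonneg (by positivity), Complex.norm_exp]
  simp

lemma differentiableAt_integral_rpow_mul_cexp_neg {α : ℝ} (hα : 0 < α) {r : ℂ} (hr : 0 < r.re) :
    DifferentiableAt ℂ (fun r : ℂ => ∫ t in Set.Ioi (0 : ℝ),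
      ((t ^ (α - 1) : ℝ) : ℂ) * Complex.exp (-(r * t))) r := by
  have key := hasDerivAt_integral_of_dominated_loc_of_deriv_le
    (μ := volume.restrict (Set.Ioi (0 : ℝ))) (x₀ := r) (s := {z : ℂ | r.re / 2 < z.re})
    (F := fun r t => ((t ^ (α - 1) : ℝ) : ℂ) * Complex.exp (-(r * t)))
    (F' := fun r t => ((t ^ (α - 1) : ℝ) : ℂ) * (Complex.exp (-(r * t)) * -(t : ℂ)))
    (bound := fun t => t ^ α * Real.exp (-(r.re / 2) * t))
    ((isOpen_lt continuous_const Complex.continuous_re).mem_nhds (half_lt_self hr))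
    (Eventually.of_forall fun x => Measurable.aestronglyMeasurable (by fun_prop))
    (integrableOn_rpow_mul_cexp_neg hα hr)
    (Measurable.aestronglyMeasurable (by fun_prop))
    ?_ (integrableOn_rpow_mul_exp_neg (by linarith) (half_pos hr)) ?_
  · exact key.2.differentiableAt
  · refine (ae_restrict_iff' measurableSet_Ioi).2 (ae_of_all _ fun t ht x hx => ?_)
    have ht : 0 < t := ht
    have hx : r.re / 2 < x.re := hx
    rw [norm_mul, norm_mul, norm_neg, Complex.norm_real, Complex.norm_real,
      Real.norm_of_nonneg (by positivity), Real.norm_of_nonneg ht.le, Complex.norm_exp]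
    have e : t ^ α = t ^ (α - 1) * t := by rw [← Real.rpow_add_one ht.ne']; ring_nf
    have : Real.exp (-(x * t : ℂ)).re ≤ Real.exp (-(r.re / 2) * t) := by
      apply Real.exp_le_exp.2
      simp
      nlinarith
    rw [e, mul_assoc, mul_comm t]
    gcongr
  · refine (ae_restrict_iff' measurableSet_Ioi).2 (ae_of_all _ fun t ht x hx => ?_)
    have h1 : HasDerivAt (fun x : ℂ => Complex.exp (-(x * t)))
        (Complex.exp (-(x * t)) * -(1 * (t : ℂ))) x :=
      (((hasDerivAt_id x).mul_const (t : ℂ)).neg).cexp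
    simpa using h1.const_mul ((t ^ (α - 1) : ℝ) : ℂ)

/-- Euler's integral for the Gamma function, scaled by a complex number with positive real part. -/
theorem integral_rpow_mul_cexp_neg {α : ℝ} (hα : 0 < α) {r : ℂ} (hr : 0 < r.re) :
    ∫ t in Set.Ioi (0 : ℝ), ((t ^ (α - 1) : ℝ) : ℂ) * Complex.exp (-(r * t)) =
      r ^ (-(α : ℂ)) * (Real.Gamma α : ℂ) := by
  have hopen : IsOpen {z : ℂ | 0 < z.re} := isOpen_lt continuous_const Complex.continuous_re
  have hL : AnalyticOnNhd ℂ (fun r : ℂ => ∫ t in Set.Ioi (0 : ℝ),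
      ((t ^ (α - 1) : ℝ) : ℂ) * Complex.exp (-(r * t))) {z : ℂ | 0 < z.re} :=
    DifferentiableOn.analyticOnNhd (fun z hz =>
      (differentiableAt_integral_rpow_mul_cexp_neg hα hz).differentiableWithinAt) hopen
  have hR : AnalyticOnNhd ℂ (fun r : ℂ => r ^ (-(α : ℂ)) * (Real.Gamma α : ℂ))
      {z : ℂ | 0 < z.re} :=
    DifferentiableOn.analyticOnNhd (fun z hz => ((differentiableAt_id.cpow
      (differentiableAt_const _) (.inl hz)).mul_const _).differentiableWithinAt) hopen
  -- Identity theorem on the right half-plane: both sides agree at positive reals accumulating at 1.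
  refine hL.eqOn_of_preconnected_of_frequently_eq hR (convex_halfSpace_re_gt 0).isPreconnected
    (z₀ := ((1 : ℝ) : ℂ)) (by simp) ?_ hr
  have hreal : ∃ᶠ x : ℝ in 𝓝[≠] 1, (∫ t in Set.Ioi (0 : ℝ),
      ((t ^ (α - 1) : ℝ) : ℂ) * Complex.exp (-((x : ℂ) * t))) =
        (x : ℂ) ^ (-(α : ℂ)) * (Real.Gamma α : ℂ) := by
    refine Eventually.frequently ?_
    filter_upwards [nhdsWithin_le_nhds (Ioi_mem_nhds (zero_lt_one' ℝ))] with x hx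
    have hx : 0 < x := hx
    have h := Real.integral_rpow_mul_exp_neg_mul_Ioi hα hx
    have h2 : (x : ℂ) ^ (-(α : ℂ)) = (((1 / x) ^ α : ℝ) : ℂ) := by
      rw [one_div, Real.inv_rpow hx.le, ← Real.rpow_neg hx.le, Complex.ofReal_cpow hx.le]
      simp
    rw [h2, ← Complex.ofReal_mul, ← h, ← integral_complex_ofReal]
    simp
  rw [frequently_iff_seq_forall] at hreal ⊢
  obtain ⟨xs, hx1, hx2⟩ := hreal
  refine ⟨fun n => xs n, ?_, hx2⟩
  rw [tendsto_nhdsWithin_iff] at hx1 ⊢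
  exact ⟨(Complex.continuous_ofReal.tendsto 1).comp hx1.1, by simpa using hx1.2⟩

/-! ### Fourier transforms of Gamma densities -/

/-- The unnormalised density of the Gamma distribution with shape `α` and rate `a`. -/
noncomputable def gammaKernel (α a : ℝ) : ℝ → ℝ :=
  (Set.Ioi 0).indicator fun t => t ^ (α - 1) * Real.exp (-a * t)

lemma integrable_gammaKernel {α a : ℝ} (hα : 0 < α) (ha : 0 < a) :
    Integrable (gammaKernel α a) :=
  (integrable_indicator_iff measurableSet_Ioi).2
    (integrableOn_rpow_mul_exp_neg (by linarith) ha)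

-- The kernel e^(-2πitw) shifts the rate from a to a + 2πiw, so Euler's integral applies.
open FourierTransform in
lemma fourier_gammaKernel {α a : ℝ} (hα : 0 < α) (ha : 0 < a) (w : ℝ) :
    𝓕 (fun t => (gammaKernel α a t : ℂ)) w =
      ((a : ℂ) + Complex.I * ((2 * Real.pi * w : ℝ) : ℂ)) ^ (-(α : ℂ)) * (Real.Gamma α : ℂ) := by
  rw [Real.fourier_real_eq_integral_exp_smul, ← integral_rpow_mul_cexp_neg hα (by simpa using ha),
    ← integral_indicator measurableSet_Ioi]
  refine integral_congr_ae (ae_of_all _ fun t => ?_)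
  simp only [gammaKernel, Set.indicator_apply]
  split_ifs with ht
  · rw [smul_eq_mul, Complex.ofReal_mul (t ^ (α - 1)), Complex.ofReal_exp, mul_left_comm,
      ← Complex.exp_add]
    congr 2
    push_cast
    ring
  · simp

open FourierTransform in
lemma fourier_comp_neg (f : ℝ → ℂ) (w : ℝ) : 𝓕 (fun t => f (-t)) w = 𝓕 f (-w) := by
  rw [Real.fourier_real_eq_integral_exp_smul, Real.fourier_real_eq_integral_exp_smul,
    ← integral_neg_eq_self]
  simp

/-- The Fourier transform of the cross-correlation of two Gamma densities. -/
noncomputable def maternKernel (α a β b x : ℝ) : ℂ :=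
  ((a : ℂ) + Complex.I * (x : ℂ)) ^ (-(α : ℂ)) * ((b : ℂ) - Complex.I * (x : ℂ)) ^ (-(β : ℂ))

lemma continuous_maternKernel (α β : ℝ) {a b : ℝ} (ha : 0 < a) (hb : 0 < b) :
    Continuous (maternKernel α a β b) := by
  unfold maternKernel
  refine Continuous.mul (Continuous.cpow (by fun_prop) (by fun_prop) fun x => .inl (by simpa))
    (Continuous.cpow (by fun_prop) (by fun_prop) fun x => .inl (by simpa))

/-- The modulus is at least a and at least |x|; average the two bounds. -/
lemma norm_add_I_mul_ge {a : ℝ} (ha : 0 < a) (x : ℝ) :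
    min a 1 / 2 * (1 + ‖x‖) ≤ ‖(a : ℂ) + Complex.I * (x : ℂ)‖ := by
  have h1 := Complex.abs_re_le_norm ((a : ℂ) + Complex.I * (x : ℂ))
  have h2 := Complex.abs_im_le_norm ((a : ℂ) + Complex.I * (x : ℂ))
  simp only [Complex.add_re, Complex.add_im, Complex.mul_re, Complex.mul_im, Complex.I_re,
    Complex.I_im, Complex.ofReal_re, Complex.ofReal_im, zero_mul, mul_zero, sub_zero, add_zero,
    zero_add, one_mul] at h1 h2
  rw [abs_of_pos ha] at h1
  rw [Real.norm_eq_abs]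
  nlinarith [min_le_left a 1, min_le_right a 1, abs_nonneg x]

lemma norm_add_I_mul_cpow_le {α a : ℝ} (hα : 0 < α) (ha : 0 < a) (x : ℝ) :
    ‖((a : ℂ) + Complex.I * (x : ℂ)) ^ (-(α : ℂ))‖ ≤ (min a 1 / 2) ^ (-α) * (1 + ‖x‖) ^ (-α) := by
  have hm : 0 < min a 1 / 2 := half_pos (lt_min ha one_pos)
  rw [← Complex.ofReal_neg, Complex.norm_cpow_real, ← Real.mul_rpow hm.le (by positivity)]
  exact Real.rpow_le_rpow_of_nonpos (by positivity) (norm_add_I_mul_ge ha x) (by linarith)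

lemma norm_maternKernel_le {α a β b : ℝ} (hα : 0 < α) (hβ : 0 < β) (ha : 0 < a) (hb : 0 < b)
    (x : ℝ) : ‖maternKernel α a β b x‖ ≤
      (min a 1 / 2) ^ (-α) * (min b 1 / 2) ^ (-β) * (1 + ‖x‖) ^ (-(α + β)) := by
  have h1 := norm_add_I_mul_cpow_le hα ha x
  have h2 := norm_add_I_mul_cpow_le hβ hb (-x)
  rw [norm_neg, Complex.ofReal_neg, mul_neg, ← sub_eq_add_neg] at h2
  rw [maternKernel, norm_mul, neg_add, Real.rpow_add (by positivity)]
  calc _ ≤ _ := mul_le_mul h1 h2 (norm_nonneg _) (by positivity)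
    _ = _ := by ring

lemma integrable_maternKernel {α a β b : ℝ} (hα : 0 < α) (hβ : 0 < β) (hαβ : 1 < α + β)
    (ha : 0 < a) (hb : 0 < b) : Integrable (maternKernel α a β b) := by
  have h : Integrable (fun x : ℝ => (1 + ‖x‖) ^ (-(α + β))) :=
    integrable_one_add_norm (by simpa using hαβ)
  exact Integrable.mono' (h.const_mul _) (continuous_maternKernel α β ha hb).aestronglyMeasurable
    (ae_of_all _ (norm_maternKernel_le hα hβ ha hb))

/-- The (unnormalised) covariance function with spectral density `maternKernel`. -/
noncomputable def maternCov (α a β b h : ℝ) : ℂ :=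
  ∫ x : ℝ, Complex.exp (Complex.I * (h : ℂ) * (x : ℂ)) * maternKernel α a β b x

/-- The change x ↦ -x exchanges the two factors of the kernel. -/
lemma maternCov_neg (α a β b h : ℝ) : maternCov α a β b (-h) = maternCov β b α a h := by
  rw [maternCov, maternCov, ← integral_neg_eq_self]
  refine integral_congr_ae (ae_of_all _ fun x => ?_)
  simp only [maternKernel]
  push_cast
  rw [mul_neg, mul_neg, mul_neg, neg_mul, neg_neg, sub_neg_eq_add, ← sub_eq_add_neg,
    mul_comm (_ ^ _) (_ ^ _)]

lemma continuous_maternCov {α a β b : ℝ} (hα : 0 < α) (hβ : 0 < β) (hαβ : 1 < α + β)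
    (ha : 0 < a) (hb : 0 < b) : Continuous (maternCov α a β b) := by
  refine continuous_of_dominated (bound := fun x => ‖maternKernel α a β b x‖) (fun h => ?_)
    (fun h => ae_of_all _ fun x => ?_) (integrable_maternKernel hα hβ hαβ ha hb).norm
    (ae_of_all _ fun x => by fun_prop)
  · have := continuous_maternKernel α β ha hb
    exact Continuous.aestronglyMeasurable (by fun_prop)
  · rw [norm_mul, Complex.norm_exp]
    simp

/-! ### Cross-correlation and Fourier inversion -/

/-- The cross-correlation of two Gamma densities. -/
noncomputable def gammaCorrelation (α a β b h : ℝ) : ℝ :=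
  ∫ s, gammaKernel α a (h + s) * gammaKernel β b s

lemma gammaCorrelation_of_nonneg (α a β b : ℝ) {h : ℝ} (hh : 0 ≤ h) :
    gammaCorrelation α a β b h = ∫ s in Set.Ioi (0 : ℝ),
      (h + s) ^ (α - 1) * Real.exp (-a * (h + s)) * (s ^ (β - 1) * Real.exp (-b * s)) := by
  rw [gammaCorrelation, ← integral_indicator measurableSet_Ioi]
  refine integral_congr_ae (ae_of_all _ fun s => ?_)
  simp only [gammaKernel, Set.indicator_apply, Set.mem_Ioi]
  split_ifs with h1 h2 h2
  · rfl
  · simp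
  · exact absurd (by linarith) h1
  · simp

/-- With s = ht, all powers of h factor out and h + s becomes h(1 + t). -/
lemma gammaCorrelation_of_pos (α a β b : ℝ) {h : ℝ} (hh : 0 < h) :
    gammaCorrelation α a β b h =
      Real.exp (-a * h) * h ^ (α + β - 1) * kummerIntegral (β - 1) (α - 1) ((a + b) * h) := by
  have hs := integral_comp_mul_left_Ioi (fun s : ℝ =>
    (h + s) ^ (α - 1) * Real.exp (-a * (h + s)) * (s ^ (β - 1) * Real.exp (-b * s))) 0 hh
  rw [mul_zero, smul_eq_mul, ← gammaCorrelation_of_nonneg α a β b hh.le] at hs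
  rw [← mul_right_inj' (inv_ne_zero hh.ne'), ← hs, kummerIntegral, ← integral_const_mul,
    ← integral_const_mul]
  refine setIntegral_congr_fun measurableSet_Ioi fun t ht => ?_
  have ht : 0 < t := ht
  have e1 : h⁻¹ * h ^ (α + β - 1) = h ^ (α - 1) * h ^ (β - 1) := by
    rw [← Real.rpow_add hh, ← Real.rpow_neg_one, ← Real.rpow_add hh]
    ring_nf
  have e2 : Real.exp (-a * (h + h * t)) * Real.exp (-b * (h * t)) =
      Real.exp (-a * h) * Real.exp (-((a + b) * h) * t) := by
    rw [← Real.exp_add, ← Real.exp_add]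
    ring_nf
  rw [show h + h * t = h * (1 + t) by ring] at *
  rw [Real.mul_rpow hh.le (by positivity), Real.mul_rpow hh.le ht.le]
  linear_combination (h ^ (α - 1) * (1 + t) ^ (α - 1) * h ^ (β - 1) * t ^ (β - 1)) * e2
    - (Real.exp (-a * h) * (Real.exp (-((a + b) * h) * t) * (t ^ (β - 1) * (1 + t) ^ (α - 1)))) * e1

lemma continuousAt_gammaCorrelation {α a β b h : ℝ} (hβ : 0 < β) (ha : 0 < a) (hb : 0 < b)
    (hh : 0 < h) : ContinuousAt (gammaCorrelation α a β b) h := by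
  have h1 : ContinuousAt (fun h => kummerIntegral (β - 1) (α - 1) ((a + b) * h)) h :=
    ContinuousAt.comp (g := kummerIntegral (β - 1) (α - 1)) (f := fun h => (a + b) * h)
      (hasDerivAt_kummerIntegral (by linarith) _ (by positivity)).continuousAt (by fun_prop)
  have h2 : ContinuousAt (fun h : ℝ => h ^ (α + β - 1)) h :=
    Real.continuousAt_rpow_const _ _ (.inl hh.ne')
  have h3 : ContinuousAt (fun h : ℝ => Real.exp (-a * h)) h := by fun_prop
  refine ((h3.mul h2).mul h1).congr ?_
  filter_upwards [Ioi_mem_nhds hh] with x hx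
  exact (gammaCorrelation_of_pos α a β b hx).symm

open FourierTransform Convolution in
theorem maternCov_of_pos {α a β b h : ℝ} (hα : 0 < α) (hβ : 0 < β) (hαβ : 1 < α + β)
    (ha : 0 < a) (hb : 0 < b) (hh : 0 < h) :
    maternCov α a β b h = ((2 * Real.pi / (Real.Gamma α * Real.Gamma β) *
      gammaCorrelation α a β b h : ℝ) : ℂ) := by
  -- The reflection turns convolution into correlation and produces the factor b - ix.
  set f₁ : ℝ → ℂ := fun t => (gammaKernel β b (-t) : ℂ)
  set f₂ : ℝ → ℂ := fun t => (gammaKernel α a t : ℂ)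
  have hf₁ : Integrable f₁ := (integrable_gammaKernel hβ hb).comp_neg.ofReal
  have hf₂ : Integrable f₂ := (integrable_gammaKernel hα ha).ofReal
  have hconv : f₁ ⋆[ContinuousLinearMap.mul ℂ ℂ] f₂ =
      fun h => (gammaCorrelation α a β b h : ℂ) := by
    ext h
    rw [convolution_def, gammaCorrelation, ← integral_complex_ofReal, ← integral_neg_eq_self]
    refine integral_congr_ae (ae_of_all _ fun s => ?_)
    simp [f₁, f₂, mul_comm]
  have hF : 𝓕 (f₁ ⋆[ContinuousLinearMap.mul ℂ ℂ] f₂) = fun w =>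
      ((Real.Gamma α * Real.Gamma β : ℝ) : ℂ) * maternKernel α a β b (2 * Real.pi * w) := by
    ext w
    rw [Real.fourier_mul_convolution_eq hf₁ hf₂, fourier_gammaKernel hα ha,
      fourier_comp_neg (fun t => (gammaKernel β b t : ℂ)), fourier_gammaKernel hβ hb, maternKernel]
    push_cast
    rw [mul_neg, mul_neg, ← sub_eq_add_neg]
    ring
  have hFint : Integrable (𝓕 (f₁ ⋆[ContinuousLinearMap.mul ℂ ℂ] f₂)) := by
    rw [hF]
    exact ((integrable_maternKernel hα hβ hαβ ha hb).comp_mul_left' (by positivity)).const_mul _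
  have hcont : ContinuousAt (f₁ ⋆[ContinuousLinearMap.mul ℂ ℂ] f₂) h := by
    rw [hconv]
    exact Complex.continuous_ofReal.continuousAt.comp (continuousAt_gammaCorrelation hβ ha hb hh)
  have hinv := (hf₁.integrable_convolution (ContinuousLinearMap.mul ℂ ℂ) hf₂).fourierInv_fourier_eq
    hFint hcont
  rw [Real.fourierInv_eq', hF, hconv] at hinv
  -- Passing from frequency w to x = 2πw accounts for the factor 2π.
  have hsub := Measure.integral_comp_mul_left
    (fun x : ℝ => Complex.exp (Complex.I * (h : ℂ) * (x : ℂ)) * maternKernel α a β b x)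
    (2 * Real.pi)
  have hint : ∫ v : ℝ, Complex.exp (((2 * Real.pi * inner ℝ v h : ℝ) : ℂ) * Complex.I) •
        (((Real.Gamma α * Real.Gamma β : ℝ) : ℂ) * maternKernel α a β b (2 * Real.pi * v)) =
      ((Real.Gamma α * Real.Gamma β : ℝ) : ℂ) * ∫ x : ℝ, Complex.exp (Complex.I * (h : ℂ) *
        ((2 * Real.pi * x : ℝ) : ℂ)) * maternKernel α a β b (2 * Real.pi * x) := by
    rw [← integral_const_mul]
    refine integral_congr_ae (ae_of_all _ fun v => ?_)
    simp only [smul_eq_mul, RCLike.inner_apply, conj_trivial]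
    rw [mul_left_comm]
    congr 3
    push_cast
    ring
  rw [hint, hsub, abs_of_pos (by positivity), ← maternCov] at hinv
  have hGα := (Real.Gamma_pos_of_pos hα).ne'
  have hGβ := (Real.Gamma_pos_of_pos hβ).ne'
  have hπ := Real.pi_ne_zero
  rw [Complex.real_smul] at hinv
  push_cast at hinv ⊢
  rw [← hinv]
  have hGα' : (Real.Gamma α : ℂ) ≠ 0 := by exact_mod_cast hGα
  have hGβ' : (Real.Gamma β : ℂ) ≠ 0 := by exact_mod_cast hGβ
  have hπ' : (Real.pi : ℂ) ≠ 0 := by exact_mod_cast hπ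
  field_simp

/-- At h = 0 the integrand is s^(α+β-2) e^(-(a+b)s), integrable because α + β > 1. -/
lemma tendsto_gammaCorrelation {α a β b : ℝ} (hβ : 0 < β) (hαβ : 1 < α + β)
    (ha : 0 < a) (hb : 0 < b) :
    Tendsto (gammaCorrelation α a β b) (𝓝[>] 0)
      (𝓝 ((1 / (a + b)) ^ (α + β - 1) * Real.Gamma (α + β - 1))) := by
  rw [← Real.integral_rpow_mul_exp_neg_mul_Ioi (by linarith) (by positivity)]
  have hlim : Tendsto (fun h : ℝ => ∫ s in Set.Ioi (0 : ℝ),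
      (h + s) ^ (α - 1) * Real.exp (-a * (h + s)) * (s ^ (β - 1) * Real.exp (-b * s))) (𝓝[>] 0)
      (𝓝 (∫ s in Set.Ioi (0 : ℝ), s ^ (α + β - 1 - 1) * Real.exp (-((a + b) * s)))) := by
    -- For 0 < h < 1, (h+s)^(α-1) is at most (1+s)^(α-1) if α ≥ 1 and at most s^(α-1) if α ≤ 1; the
    -- sum dominates in both cases.
    have i1 := integrableOn_kummerIntegrand (p := β - 1) (by linarith) (α - 1) hb
    have i2 := integrableOn_kummerIntegrand (p := α + β - 2) (by linarith) 0 hb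
    refine tendsto_integral_filter_of_dominated_convergence _ ?_ ?_ (i1.add i2) ?_
    · exact Eventually.of_forall fun h => Measurable.aestronglyMeasurable (by fun_prop)
    · filter_upwards [Ioo_mem_nhdsGT (zero_lt_one' ℝ)] with h hh
      refine (ae_restrict_iff' measurableSet_Ioi).2 (ae_of_all _ fun s hs => ?_)
      have hs : 0 < s := hs
      have hh0 := hh.1
      rw [Real.norm_of_nonneg (by positivity)]
      have e : s ^ (α + β - 2) = s ^ (α - 1) * s ^ (β - 1) := by
        rw [← Real.rpow_add hs]; ring_nf
      have h1 : (h + s) ^ (α - 1) ≤ (1 + s) ^ (α - 1) + s ^ (α - 1) := by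
        have p1 : 0 ≤ (1 + s) ^ (α - 1) := by positivity
        have p2 : 0 ≤ s ^ (α - 1) := by positivity
        rcases le_total 0 (α - 1) with hα | hα
        · have := Real.rpow_le_rpow (by positivity) (show h + s ≤ 1 + s by linarith [hh.2]) hα
          linarith
        · have := Real.rpow_le_rpow_of_nonpos hs (show s ≤ h + s by linarith) hα
          linarith
      have h2 : Real.exp (-a * (h + s)) ≤ 1 := Real.exp_le_one_iff.2 (by nlinarith)
      simp only [Pi.add_apply, Real.rpow_zero, e]
      calc (h + s) ^ (α - 1) * Real.exp (-a * (h + s)) * (s ^ (β - 1) * Real.exp (-b * s))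
          ≤ ((1 + s) ^ (α - 1) + s ^ (α - 1)) * 1 * (s ^ (β - 1) * Real.exp (-b * s)) := by
            gcongr
        _ = _ := by ring
    · refine (ae_restrict_iff' measurableSet_Ioi).2 (ae_of_all _ fun s hs => ?_)
      have hs : 0 < s := hs
      have hc : ContinuousAt (fun h : ℝ =>
          (h + s) ^ (α - 1) * Real.exp (-a * (h + s)) * (s ^ (β - 1) * Real.exp (-b * s))) 0 := by
        have : ContinuousAt (fun h : ℝ => (h + s) ^ (α - 1)) 0 :=
          (continuousAt_id.add continuousAt_const).rpow_const (.inl (by simpa using hs.ne'))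
        fun_prop
      have h1 := hc.tendsto.mono_left (nhdsWithin_le_nhds (s := Set.Ioi 0))
      convert h1 using 2
      rw [zero_add, show α + β - 1 - 1 = (α - 1) + (β - 1) by ring, Real.rpow_add hs,
        show -((a + b) * s) = -a * s + -b * s by ring, Real.exp_add]
      ring
  refine hlim.congr' ?_
  filter_upwards [self_mem_nhdsWithin] with h hh
  exact (gammaCorrelation_of_nonneg α a β b (le_of_lt hh)).symm

/-- The covariance is continuous, so its value at 0 is the limit of the formula for h > 0; no
inversion at 0 is needed. -/
theorem maternCov_zero {α a β b : ℝ} (hα : 0 < α) (hβ : 0 < β) (hαβ : 1 < α + β)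
    (ha : 0 < a) (hb : 0 < b) :
    maternCov α a β b 0 = ((2 * Real.pi / (Real.Gamma α * Real.Gamma β) *
      ((1 / (a + b)) ^ (α + β - 1) * Real.Gamma (α + β - 1)) : ℝ) : ℂ) := by
  have h1 : Tendsto (maternCov α a β b) (𝓝[>] 0) (𝓝 (maternCov α a β b 0)) :=
    ((continuous_maternCov hα hβ hαβ ha hb).tendsto 0).mono_left nhdsWithin_le_nhds
  have h2 := (Complex.continuous_ofReal.tendsto _).comp ((tendsto_gammaCorrelation hβ hαβ ha
    hb).const_mul (2 * Real.pi / (Real.Gamma α * Real.Gamma β)))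
  refine tendsto_nhds_unique h1 (h2.congr' ?_)
  filter_upwards [self_mem_nhdsWithin] with h hh
  exact (maternCov_of_pos hα hβ hαβ ha hb hh).symm

/-! ### Normalising constants and the Whittaker form -/

/-- Legendre's duplication formula trades Γ(ν) for Γ(2ν) and brings Γ(ν + 1/2) outside the root,
where it cancels the Gamma factor of `maternCov_zero`. -/
lemma maternConst_one_eq {ν a : ℝ} (hν : 0 < ν) (ha : 0 < a) :
    maternConst 1 ν a = a ^ ν * Real.Gamma (ν + 1 / 2) * 2 ^ (ν - 1 / 2) /
      (Real.sqrt Real.pi * Real.sqrt (Real.Gamma (2 * ν))) := by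
  have hG := Real.Gamma_pos_of_pos hν
  have hG2 := Real.Gamma_pos_of_pos (show 0 < 2 * ν by linarith)
  have hG3 := Real.Gamma_pos_of_pos (show 0 < ν + 1 / 2 by linarith)
  have hπ := Real.sqrt_pos.2 Real.pi_pos
  rw [maternConst, Real.sqrt_eq_iff_mul_self_eq (by positivity) (by positivity)]
  have hdup := Real.Gamma_mul_Gamma_add_half ν
  have e1 : a ^ (2 * ν) = a ^ ν * a ^ ν := by rw [two_mul, Real.rpow_add ha]
  have e2 : (2 : ℝ) ^ (ν - 1 / 2) * 2 ^ (ν - 1 / 2) * 2 ^ (1 - 2 * ν) = 1 := by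
    rw [← Real.rpow_add two_pos, ← Real.rpow_add two_pos]
    ring_nf
    simp
  have e3 : Real.pi ^ (((1 : ℕ) : ℝ) / 2) = Real.sqrt Real.pi := by
    rw [Real.sqrt_eq_rpow]; simp
  rw [e3, e1, Nat.cast_one, div_mul_div_comm, div_eq_div_iff (by positivity) (by positivity)]
  have s1 := Real.mul_self_sqrt hG2.le
  set T := Real.sqrt (Real.Gamma (2 * ν))
  set Q := Real.sqrt Real.pi
  rw [← s1] at hdup
  linear_combination
    (-(a ^ ν * a ^ ν * Real.Gamma (ν + 1 / 2) * Q * 2 ^ (ν - 1 / 2) * 2 ^ (ν - 1 / 2))) * hdup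
    - (a ^ ν * a ^ ν * Real.Gamma (ν + 1 / 2) * Q * Q * T * T) * e2

lemma maternSpectralDensity_eq_of_im_eq_zero {p : ℕ} (a ν : Fin p → ℝ)
    (S : Matrix (Fin p) (Fin p) ℂ) (j k : Fin p) (hS : (S j k).im = 0) (x : ℝ) :
    maternSpectralDensity a ν S x j k =
      (((S j k).re * maternConst 1 (ν j) (a j) * maternConst 1 (ν k) (a k) : ℝ) : ℂ) *
        maternKernel (ν j + 1 / 2) (a j) (ν k + 1 / 2) (a k) x := by
  have e (y : ℝ) : -((y + 1 / 2 : ℝ) : ℂ) = -(y : ℂ) - 1 / 2 := by push_cast; ring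
  simp only [maternSpectralDensity, Matrix.of_apply, hS, maternKernel, e]
  push_cast
  ring

lemma spectralCov_maternSpectralDensity_of_im_eq_zero {p : ℕ} (a ν : Fin p → ℝ)
    (S : Matrix (Fin p) (Fin p) ℂ) (j k : Fin p) (hS : (S j k).im = 0) (h : ℝ) :
    spectralCov (maternSpectralDensity a ν S) h j k =
      (((S j k).re * maternConst 1 (ν j) (a j) * maternConst 1 (ν k) (a k) : ℝ) : ℂ) *
        maternCov (ν j + 1 / 2) (a j) (ν k + 1 / 2) (a k) h := by
  simp only [spectralCov, Matrix.of_apply, maternSpectralDensity_eq_of_im_eq_zero a ν S j k hS,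
    maternCov]
  rw [← integral_const_mul]
  refine integral_congr_ae (ae_of_all _ fun x => ?_)
  simp only
  ring

/-- Here κ = (ν-μ)/2 makes the first parameter of U equal to μ + 1/2, so U absorbs 1/Γ(μ + 1/2) and
only Γ(ν + 1/2) remains. The exponential splits by a = (a-b)/2 + (a+b)/2. -/
theorem maternCov_eq_whittakerW {ν a μ b h : ℝ} (hν : 0 < ν) (hμ : 0 < μ) (ha : 0 < a)
    (hb : 0 < b) (hh : 0 < h) :
    maternCov (ν + 1 / 2) a (μ + 1 / 2) b h =
      ((Real.pi / ((a + b) / 2) * (h / (2 * ((a + b) / 2))) ^ ((ν + μ) / 2 - 1 / 2) *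
        Real.exp (-h * ((a - b) / 2)) *
        (whittakerW ((ν - μ) / 2) ((ν + μ) / 2) (2 * ((a + b) / 2) * h) /
          Real.Gamma (ν + 1 / 2)) : ℝ) : ℂ) := by
  rw [maternCov_of_pos (by linarith) (by linarith) (by linarith) ha hb hh,
    gammaCorrelation_of_pos _ _ _ _ hh, whittakerW,
    tricomiU_eq_kummerIntegral _ (by linarith) (by positivity)]
  have hab : 0 < a + b := by linarith
  have e1 : 2 * ((a + b) / 2) = a + b := by ring
  have e2 : 1 / 2 + (ν + μ) / 2 - (ν - μ) / 2 = μ + 1 / 2 := by ring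
  have e3 : 1 + 2 * ((ν + μ) / 2) - (μ + 1 / 2) - 1 = ν + 1 / 2 - 1 := by ring
  have e4 : Real.exp (-a * h) =
      Real.exp (-h * ((a - b) / 2)) * Real.exp (-(1 / 2) * ((a + b) * h)) := by
    rw [← Real.exp_add]; ring_nf
  have e5 : ν + 1 / 2 + (μ + 1 / 2) - 1 = ((ν + μ) / 2 - 1 / 2) + (1 / 2 + (ν + μ) / 2) := by ring
  have e6 : (a + b) ^ (1 / 2 + (ν + μ) / 2) = (a + b) * (a + b) ^ ((ν + μ) / 2 - 1 / 2) := by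
    rw [← Real.rpow_one_add' hab.le (by linarith)]; ring_nf
  rw [e1, e2, e3, e4, e5, Real.rpow_add hh, Real.div_rpow hh.le hab.le, Real.mul_rpow hab.le hh.le,
    e6]
  have hG1 := (Real.Gamma_pos_of_pos (show 0 < ν + 1 / 2 by linarith)).ne'
  have hG2 := (Real.Gamma_pos_of_pos (show 0 < μ + 1 / 2 by linarith)).ne'
  have hp := (Real.rpow_pos_of_pos hab ((ν + μ) / 2 - 1 / 2)).ne'
  congr 1
  generalize Real.Gamma (ν + 1 / 2) = G1 at *
  generalize Real.Gamma (μ + 1 / 2) = G2 at *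
  generalize (a + b) ^ ((ν + μ) / 2 - 1 / 2) = R at *
  generalize h ^ ((ν + μ) / 2 - 1 / 2) = R1
  generalize h ^ (1 / 2 + (ν + μ) / 2) = R2
  generalize Real.exp (-h * ((a - b) / 2)) = E1
  generalize Real.exp (-(1 / 2) * ((a + b) * h)) = E2
  generalize kummerIntegral _ _ _ = J
  field_simp

theorem theorem3p1 {p : ℕ} (a ν : Fin p → ℝ) (ha : ∀ j, 0 < a j) (hν : ∀ j, 0 < ν j)
    (S : Matrix (Fin p) (Fin p) ℂ) (j k : Fin p) (hS : (S j k).im = 0)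
    (C : ℝ → ℂ) (hC : ∀ h : ℝ, C h = spectralCov (maternSpectralDensity a ν S) h j k)
    (aplus aminus νplus νminus : ℝ)
    (haplus : aplus = (a j + a k) / 2) (haminus : aminus = (a j - a k) / 2)
    (hνplus : νplus = (ν j + ν k) / 2) (hνminus : νminus = (ν j - ν k) / 2) :
    -- the cross-spectral density is integrable, so that `C` is a genuine Fourier integral
    Integrable (fun x : ℝ => maternSpectralDensity a ν S x j k) ∧
    -- `C` is the cross-covariance of every process with this spectral density
    (∀ (Ω : Type*) [MeasurableSpace Ω] (P : Measure Ω) [IsProbabilityMeasure P]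
        (Y : ℝ → Ω → Fin p → ℝ), HasSpectralDensity P Y (maternSpectralDensity a ν S) →
        ∀ s h : ℝ, ((∫ ω, Y (s + h) ω j * Y s ω k ∂P : ℝ) : ℂ) = C h) ∧
    (∀ h : ℝ, 0 < h →
      C h = (((S j k).re * maternConst 1 (ν j) (a j) * maternConst 1 (ν k) (a k) *
        (Real.pi / aplus) * (|h| / (2 * aplus)) ^ (νplus - 1 / 2) * Real.exp (-h * aminus) *
        (whittakerW νminus νplus (2 * aplus * |h|) / Real.Gamma (ν j + 1 / 2)) : ℝ) : ℂ)) ∧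
    (∀ h : ℝ, h < 0 →
      C h = (((S j k).re * maternConst 1 (ν j) (a j) * maternConst 1 (ν k) (a k) *
        (Real.pi / aplus) * (|h| / (2 * aplus)) ^ (νplus - 1 / 2) * Real.exp (-h * aminus) *
        (whittakerW (-νminus) νplus (2 * aplus * |h|) / Real.Gamma (ν k + 1 / 2)) : ℝ) : ℂ)) ∧
    C 0 = (((S j k).re * ((a j) ^ (ν j) * (a k) ^ (ν k) / aplus ^ (2 * νplus)) *
        (Real.Gamma (2 * νplus) /
          Real.sqrt (Real.Gamma (2 * ν j) * Real.Gamma (2 * ν k))) : ℝ) : ℂ) := by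
  subst haplus haminus hνplus hνminus
  have hj := ha j
  have hk := ha k
  have hνj := hν j
  have hνk := hν k
  have hC' := fun h => (hC h).trans (spectralCov_maternSpectralDensity_of_im_eq_zero a ν S j k hS h)
  refine ⟨?_, ?_, fun h hh => ?_, fun h hh => ?_, ?_⟩
  · simp only [maternSpectralDensity_eq_of_im_eq_zero a ν S j k hS]
    exact (integrable_maternKernel (by linarith) (by linarith) (by linarith) hj hk).const_mul _
  · intro Ω _ P _ Y hY s h
    rw [hY.cov_eq, hC, add_sub_cancel_left]
  · rw [hC', maternCov_eq_whittakerW hνj hνk hj hk hh, abs_of_pos hh, ← Complex.ofReal_mul]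
    congr 1
    ring
  -- Reflection exchanges j and k, reversing the signs of a_- and ν_-.
  · have hneg : 0 < -h := by linarith
    rw [hC', ← neg_neg h, maternCov_neg, maternCov_eq_whittakerW hνk hνj hk hj hneg, neg_neg,
      abs_of_neg hh, ← Complex.ofReal_mul, add_comm (a k), add_comm (ν k),
      show (ν k - ν j) / 2 = -((ν j - ν k) / 2) by ring,
      show h * ((a k - a j) / 2) = -h * ((a j - a k) / 2) by ring]
    congr 1
    ring
  · rw [hC', maternCov_zero (by linarith) (by linarith) (by linarith) hj hk, ← Complex.ofReal_mul]
    congr 1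
    have hab : 0 < a j + a k := by linarith
    have hGj := (Real.Gamma_pos_of_pos (show 0 < ν j + 1 / 2 by linarith)).ne'
    have hGk := (Real.Gamma_pos_of_pos (show 0 < ν k + 1 / 2 by linarith)).ne'
    have hGj2 := Real.Gamma_pos_of_pos (show 0 < 2 * ν j by linarith)
    have hGk2 := Real.Gamma_pos_of_pos (show 0 < 2 * ν k by linarith)
    have hsj := (Real.sqrt_pos.2 hGj2).ne'
    have hsk := (Real.sqrt_pos.2 hGk2).ne'
    have hπ := (Real.sqrt_pos.2 Real.pi_pos).ne'
    have hππ := Real.mul_self_sqrt Real.pi_pos.le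
    have hR := (Real.rpow_pos_of_pos hab (ν j + ν k)).ne'
    have e1 : ν j + 1 / 2 + (ν k + 1 / 2) - 1 = ν j + ν k := by ring
    have e2 : 2 * ((ν j + ν k) / 2) = ν j + ν k := by ring
    -- The 2 of 2π and the powers of 2 in the two constants together cancel the halving in a_+.
    have e3 : (2 : ℝ) ^ (ν j + ν k) = 2 * 2 ^ (ν j - 1 / 2) * 2 ^ (ν k - 1 / 2) := by
      rw [← Real.rpow_one_add' zero_le_two (by linarith), ← Real.rpow_add two_pos]
      ring_nf
    rw [maternConst_one_eq hνj hj, maternConst_one_eq hνk hk, e1, e2, Real.sqrt_mul hGj2.le,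
      one_div (a j + a k), Real.inv_rpow hab.le, Real.div_rpow hab.le zero_le_two, e3]
    generalize (a j + a k) ^ (ν j + ν k) = R at *
    generalize Real.Gamma (ν j + 1 / 2) = G1 at *
    generalize Real.Gamma (ν k + 1 / 2) = G2 at *
    have hQ : Real.pi = Real.sqrt Real.pi ^ 2 := by rw [sq, hππ]
    rw [show 2 * Real.pi / (G1 * G2) = 2 * Real.sqrt Real.pi ^ 2 / (G1 * G2) by rw [← hQ]]
    generalize Real.sqrt Real.pi = Q at *
    field_simp
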